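/- A multidimensional matrix of format $(k_0+1)\times\dots\times(k_p+1)$ ($k_i\ge 0$ integers) is a complex family $A=(a_{i_0,\dots,i_p})$, $0\le i_r\le k_r$. It is *degenerate* if there are nonzero vectors $v_r\in\mathbb C^{k_r+1}$, $r=1,\dots,p$, such that $$\sum_{i_1,\dots,i_p}a_{i_0,i_1,\dots,i_p}\,v_1(i_1)\cdots v_p(i_p)=0\quad\text{for all } i_0,$$ and *nondegenerate* otherwise (the index $0$ is the distinguished index). The format is a *boundary format* if $k_0=k_1+\dots+k_p$. Given $B$ of format $(l_0+1)\times\dots\times(l_q+1)$ and indices $r,s$ with $k_r=l_s$, the *convolution* $A\ast_{r,s}B$ is the multidimensional matrix indexed by all the indices of $A$ except the $r$-th and all those of $B$ except the $s$-th, with entries $$\sum_{h=0}^{k_r}a_{i_0,\dots,i_{r-1},h,i_{r+1},\dots,i_p}\;b_{j_0,\dots,j_{s-1},h,j_{s+1},\dots,j_q}.$$ **Corollary.** (1) Let $A$ and $B$ be of boundary format, $1\le j\le q$ and $k_0=l_j$. Then $A\ast_{0,j}B$, with the index $0$ of $B$ as its distinguished index, is nondegenerate if and only if both $A$ and $B$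 are nondegenerate. (2) Outside boundary format, the implication from "$A$ and $B$ nondegenerate" to "the convolution nondegenerate" fails for degeneracy in the sense of the general hyperdeterminant, where a matrix is called degenerate if there are nonzero vectors, one for each of its indices, at which the multilinear form with this matrix of coefficients and all of its partial derivatives vanish (no index is distinguished). Namely, let $A$ and $B$ be of format $2\times2\times2$, where the nonzero entries of $A$ are exactly $a_{000},a_{111}$ and those of $B$ are exactly $b_{001},b_{110}$. Then $A$ and $B$ are nondegenerate in this sense, but every convolution $A\ast_{r,s}B$ ($r,s\in\{0,1,2\}$) is degenerate in this sense. -/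

import Mathlib

/-- A complex multidimensional matrix with index set `ι` and format `∏ i, (k i + 1)`: a family of
entries `a_m`, one for each multi-index `m` with `0 ≤ m i ≤ k i`; in coordinates, an element of
the tensor product of the spaces `V i`, where `dim V i = k i + 1`. -/
abbrev MultiMatrix {ι : Type*} (k : ι → ℕ) : Type _ :=
  (∀ i, Fin (k i + 1)) → ℂ

namespace MultiMatrix

variable {ι κ : Type*} [Fintype ι] [DecidableEq ι] [Fintype κ] [DecidableEq κ]

/-- The multi-index whose `o`-th entry is `h` and whose other entries are those of `m`. -/
def glue {k : ι → ℕ} (o : ι) (h : Fin (k o + 1)) (m : ∀ i : {i // i ≠ o}, Fin (k i + 1)) :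
    ∀ i, Fin (k i + 1) :=
  (Equiv.piSplitAt o fun i => Fin (k i + 1)).symm (h, m)

/-- The value at `⊗_{i ≠ o} v i` of the linear map `⊗_{i ≠ o} (V i)* → V o` given by `A`. -/
def apply {k : ι → ℕ} (A : MultiMatrix k) (o : ι)
    (v : ∀ i : {i // i ≠ o}, Fin (k i + 1) → ℂ) : Fin (k o + 1) → ℂ :=
  fun h => ∑ m : ∀ i : {i // i ≠ o}, Fin (k i + 1), A (glue o h m) * ∏ i, v i (m i)

/-- `A` is degenerate, `o` being the distinguished index (the index `0` of `V_0 ⊗ … ⊗ V_p`):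
the map above kills a decomposable tensor with nonzero factors. -/
def IsDegenerate {k : ι → ℕ} (A : MultiMatrix k) (o : ι) : Prop :=
  ∃ v : ∀ i : {i // i ≠ o}, Fin (k i + 1) → ℂ, (∀ i, v i ≠ 0) ∧ A.apply o v = 0

/-- `A` is nondegenerate, `o` being the distinguished index. -/
def IsNondegenerate {k : ι → ℕ} (A : MultiMatrix k) (o : ι) : Prop :=
  ¬ A.IsDegenerate o

/-- The format `k` is a boundary format, `o` being the distinguished index. -/
def IsBoundaryFormat (k : ι → ℕ) (o : ι) : Prop :=
  k o = ∑ i : {i // i ≠ o}, k i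

/-- The format of the convolution with respect to the indices `r`, `s`. -/
def convFormat (k : ι → ℕ) (l : κ → ℕ) (r : ι) (s : κ) : {i // i ≠ r} ⊕ {j // j ≠ s} → ℕ :=
  Sum.elim (fun i => k i) (fun j => l j)

/-- The convolution `A ∗_{r,s} B`: the index `r` of `A` is contracted with the index `s` of `B`,
and the indices of the result are the remaining ones of `A` and of `B`. -/
def conv {k : ι → ℕ} {l : κ → ℕ} (A : MultiMatrix k) (B : MultiMatrix l) (r : ι) (s : κ)
    (hrs : k r = l s) : MultiMatrix (convFormat k l r s) :=
  fun m => ∑ h : Fin (k r + 1),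
    A (glue r h fun i => m (Sum.inl i)) *
      B (glue s (Fin.cast (congrArg (· + 1) hrs) h) fun j => m (Sum.inr j))

/-- The multilinear form `∑ m, a_m ∏ i, x i (m i)` with coefficients `A`. -/
def form {k : ι → ℕ} (A : MultiMatrix k) (x : ∀ i, Fin (k i + 1) → ℂ) : ℂ :=
  ∑ m : ∀ i, Fin (k i + 1), A m * ∏ i, x i (m i)

/-- `A` is degenerate in the sense of the general hyperdeterminant (without a distinguished index):
the hyperplane defined by `A` is tangent to the Segre variety at some point `⊗ x i`, that is, it
contains all the tensors obtained from `⊗ x i` by replacing one factor by an arbitrary vector.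
As the form is multilinear, this says that `x` is a zero of the form and of all of its partial
derivatives. -/
def IsTangentDegenerate {k : ι → ℕ} (A : MultiMatrix k) : Prop :=
  ∃ x : ∀ i, Fin (k i + 1) → ℂ, (∀ i, x i ≠ 0) ∧
    ∀ (i : ι) (y : Fin (k i + 1) → ℂ), A.form (Function.update x i y) = 0

end MultiMatrix

/-!
If the index `0` of `A` is contracted with the index `j` of `B`, the linear map attached to the
convolution is that of `B` with the value of the map of `A` substituted for the `j`-th argument
(`MultiMatrix.conv_form_eq_form`, `MultiMatrix.conv_isDegenerate_iff`). Nondegeneracy of both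
factors therefore passes to the convolution, and degeneracy of `A` makes the convolution
degenerate.

If `B` is degenerate at `x`, one needs arguments of `A` with value in the line spanned by `x j`.
This is where the boundary format of `A` enters: the condition amounts to `k 0` multilinear
equations on a product of projective spaces of dimension `∑ k i = k 0`, and such a system always
has a solution (`MultiMatrix.exists_form_eq_zero`). To see this, suppose that there is none. By
the Nullstellensatz every polynomial of large multidegree `(d, …, d)` lies in the ideal of the
`N = k 0` forms, so that the space of these polynomials is the sum of the multiples of the forms by
polynomials of multidegree `(d - 1, …, d - 1)`. By iteration its dimension is `O(d ^ (N - 1))`,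
whereas counting monomials gives a lower bound of order `d ^ N`.

For the second part, a matrix of format `2 × 2 × 2` supported at two opposite vertices of the cube
is not tangent degenerate, but it is degenerate with respect to each of its indices, and whenever
`A` is degenerate with respect to `r` and `B` with respect to `s`, the convolution is tangent
degenerate (`MultiMatrix.isTangentDegenerate_conv`).
-/

/-! ### Graded pieces of polynomial rings -/

open MvPolynomial Finsupp in
theorem MvPolynomial.weightedHomogeneousComponent_mul_of_left {R σ M : Type*} [CommSemiring R]
    [AddCommMonoid M] [IsLeftCancelAdd M] {w : σ → M} {f : MvPolynomial σ R} {m : M}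
    (hf : IsWeightedHomogeneous w f m) (n : M) (g : MvPolynomial σ R) :
    weightedHomogeneousComponent w (m + n) (f * g) = f * weightedHomogeneousComponent w n g := by
  classical
  induction g using MvPolynomial.induction_on' with
  | monomial d a =>
    have hd : IsWeightedHomogeneous w (monomial d a) (weight w d) :=
      isWeightedHomogeneous_monomial w d a rfl
    rw [weightedHomogeneousComponent_of_mem hd, weightedHomogeneousComponent_of_mem (hf.mul hd)]
    simp only [add_right_inj, mul_ite, mul_zero]
  | add p q hp hq => rw [mul_add, map_add, map_add, mul_add, hp, hq]

/-- If `S (n + 1) ≤ ∑ j, f j * S n` for all `n ≥ D`, then `S (D + n)` is spanned by the products of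
a monomial of degree `n` in the `f j` and a generator of `S D`. -/
theorem Submodule.le_span_sym_map_prod_mul {K R J β : Type*} [Field K] [CommRing R] [Algebra K R]
    (f : J → R) (S : ℕ → Submodule K R) (D : ℕ)
    (hS : ∀ n, D ≤ n → S (n + 1) ≤ ⨆ j, (S n).map (LinearMap.mulLeft K (f j)))
    (b : β → R) (hb : S D ≤ span K (Set.range b)) (n : ℕ) :
    S (D + n) ≤ span K (Set.range fun s : Sym J n × β ↦ (s.1.1.map f).prod * b s.2) := by
  induction n with
  | zero =>
    refine hb.trans (span_mono ?_)
    rintro _ ⟨x, rfl⟩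
    exact ⟨(Sym.nil, x), by simp⟩
  | succ n ih =>
    refine (hS (D + n) (Nat.le_add_right D n)).trans (iSup_le fun j ↦ (map_mono ih).trans ?_)
    rw [map_span, span_le]
    rintro _ ⟨_, ⟨⟨s, x⟩, rfl⟩, rfl⟩
    exact subset_span ⟨(j ::ₛ s, x), by simp [Sym.cons, mul_assoc]⟩

/-! ### Common zeros of multilinear forms -/

namespace MultiMatrix

open MvPolynomial Finsupp

variable {ι : Type*} [Fintype ι] [DecidableEq ι] {k : ι → ℕ}

/-- The multidegree on polynomials in the coordinates of vectors `x i` of length `k i + 1`: the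
variable `⟨i, a⟩`, the coordinate `a` of `x i`, has as its weight the basis vector `i` of `ι → ℕ`.
-/
def blockWeight (k : ι → ℕ) : (Σ i, Fin (k i + 1)) → ι → ℕ :=
  fun s ↦ Pi.single s.1 1

theorem weight_blockWeight (d : (Σ i, Fin (k i + 1)) →₀ ℕ) (i : ι) :
    weight (blockWeight k) d i = ∑ a, d ⟨i, a⟩ := by
  rw [weight_eq_sum, Finset.sum_apply, Fintype.sum_sigma, Finset.sum_eq_single i]
  · simp [blockWeight]
  · intro j _ hj
    simp [blockWeight, Pi.single_eq_of_ne hj.symm]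
  · simp

/-- The form of `A` as a polynomial in the coordinates `⟨i, a⟩` of its arguments. -/
noncomputable def toPoly (A : MultiMatrix k) : MvPolynomial (Σ i, Fin (k i + 1)) ℂ :=
  ∑ m : ∀ i, Fin (k i + 1), C (A m) * ∏ i, X ⟨i, m i⟩

theorem aeval_toPoly (A : MultiMatrix k) (x : (Σ i, Fin (k i + 1)) → ℂ) :
    aeval x A.toPoly = A.form fun i a ↦ x ⟨i, a⟩ := by
  simp [toPoly, form, map_sum, map_prod]

theorem isWeightedHomogeneous_toPoly (A : MultiMatrix k) :
    IsWeightedHomogeneous (blockWeight k) A.toPoly 1 := by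
  refine IsWeightedHomogeneous.sum _ _ _ fun m _ ↦ IsWeightedHomogeneous.C_mul ?_ _
  have := IsWeightedHomogeneous.prod (R := ℂ) Finset.univ
    (fun i ↦ X (⟨i, m i⟩ : Σ i, Fin (k i + 1))) (fun i ↦ Pi.single i 1) (w := blockWeight k)
    fun i _ ↦ isWeightedHomogeneous_X ℂ (blockWeight k) _
  convert this
  exact (Finset.univ_sum_single (1 : ι → ℕ)).symm

section NoCommonZero

variable {J : Type*} {F : J → MultiMatrix k}

/-- If the forms `F j` have no common zero with nonzero components, then their ideal contains all
monomials of large multidegree: on the zero locus every product `∏ i, x i (a i)` vanishes, so by the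
Nullstellensatz a power of it lies in the ideal. -/
theorem exists_monomial_mem_span_toPoly
    (hF : ∀ x : ∀ i, Fin (k i + 1) → ℂ, (∀ i, x i ≠ 0) → ∃ j, (F j).form x ≠ 0) :
    ∃ D : ℕ, ∀ d, (∀ i, D ≤ weight (blockWeight k) d i) →
      monomial d 1 ∈ Ideal.span (Set.range fun j ↦ (F j).toPoly) := by
  set I := Ideal.span (Set.range fun j ↦ (F j).toPoly)
  have hrad (a : ∀ i, Fin (k i + 1)) :
      ∏ i, (X ⟨i, a i⟩ : MvPolynomial (Σ i, Fin (k i + 1)) ℂ) ∈ I.radical := by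
    rw [← vanishingIdeal_zeroLocus_eq_radical (K := ℂ), mem_vanishingIdeal_iff]
    intro x hx
    have hz : ∃ i, (fun b ↦ x ⟨i, b⟩ : Fin (k i + 1) → ℂ) = 0 := by
      by_contra! h
      obtain ⟨j, hj⟩ := hF (fun i a ↦ x ⟨i, a⟩) h
      exact hj (by rw [← aeval_toPoly]; exact hx _ (Ideal.subset_span ⟨j, rfl⟩))
    obtain ⟨i, hi⟩ := hz
    rw [map_prod]
    exact Finset.prod_eq_zero (Finset.mem_univ i) (by simpa using congrFun hi (a i))
  choose M hM using hrad
  set N := Finset.univ.sup M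
  refine ⟨(∑ i, k i + 1) * N, fun d hd ↦ ?_⟩
  -- In each block, one of the exponents is at least `N`.
  have hex (i : ι) : ∃ a, N ≤ d ⟨i, a⟩ := by
    by_contra! h
    refine (hd i).not_gt ?_
    rw [weight_blockWeight]
    refine (Finset.sum_lt_sum_of_nonempty Finset.univ_nonempty fun a _ ↦ h a).trans_le ?_
    simpa using Nat.mul_le_mul_right N (Nat.succ_le_succ
      (Finset.single_le_sum (fun _ _ ↦ Nat.zero_le _) (Finset.mem_univ i)))
  choose a ha using hex
  have hdvd : (∏ i, (X ⟨i, a i⟩ : MvPolynomial (Σ i, Fin (k i + 1)) ℂ)) ^ N ∣ monomial d 1 := by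
    have : (∏ i, (X ⟨i, a i⟩ : MvPolynomial (Σ i, Fin (k i + 1)) ℂ)) ^ N =
        monomial (∑ i, single ⟨i, a i⟩ N) 1 := by
      simp only [← Finset.prod_pow, X_pow_eq_monomial]
      rw [monomial_sum_one]
    rw [this]
    refine monomial_dvd_monomial.2 ⟨Or.inr fun s ↦ ?_, dvd_rfl⟩
    rw [finsetSum_apply]
    obtain ⟨i, b⟩ := s
    rw [Finset.sum_eq_single i]
    · rw [single_apply]
      split_ifs with h
      · rw [← h]; exact ha i
      · exact Nat.zero_le _
    · intro j _ hj
      exact single_eq_of_ne fun h ↦ hj (congrArg Sigma.fst h).symm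
    · simp
  exact I.mem_of_dvd (dvd_trans (pow_dvd_pow _ (Finset.le_sup (Finset.mem_univ a))) hdvd) (hM a)

theorem weightedHomogeneousSubmodule_succ_le_iSup [Fintype J] {n : ℕ}
    (hn : ∀ d, weight (blockWeight k) d = (fun _ ↦ n + 1) →
      monomial d 1 ∈ Ideal.span (Set.range fun j ↦ (F j).toPoly)) :
    weightedHomogeneousSubmodule ℂ (blockWeight k) (fun _ ↦ n + 1) ≤
      ⨆ j, (weightedHomogeneousSubmodule ℂ (blockWeight k) fun _ ↦ n).map
        (LinearMap.mulLeft ℂ (F j).toPoly) := by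
  intro p hp
  have hpI : p ∈ Ideal.span (Set.range fun j ↦ (F j).toPoly) := by
    rw [p.as_sum]
    refine sum_mem fun d hd ↦ ?_
    rw [← mul_one (coeff d p), ← C_mul_monomial]
    exact Ideal.mul_mem_left _ _ (hn d (hp (MvPolynomial.mem_support_iff.1 hd)))
  obtain ⟨c, hc⟩ := Ideal.mem_span_range_iff_exists_fun.1 hpI
  rw [← IsWeightedHomogeneous.weightedHomogeneousComponent_same hp, ← hc, map_sum]
  refine sum_mem fun j _ ↦ Submodule.mem_iSup_of_mem j ?_
  rw [mul_comm, show (fun _ ↦ n + 1 : ι → ℕ) = 1 + fun _ ↦ n from funext fun _ ↦ Nat.add_comm n 1,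
    weightedHomogeneousComponent_mul_of_left (isWeightedHomogeneous_toPoly (F j))]
  exact ⟨_, weightedHomogeneousComponent_mem _ _ _, rfl⟩

end NoCommonZero

theorem finite_setOf_weight_blockWeight_eq (n : ι → ℕ) :
    {d : (Σ i, Fin (k i + 1)) →₀ ℕ | weight (blockWeight k) d = n}.Finite := by
  refine (Set.finite_Iic (equivFunOnFinite.symm fun s : Σ i, Fin (k i + 1) ↦ n s.1)).subset ?_
  rintro d rfl ⟨i, a⟩
  simp only [equivFunOnFinite_symm_apply_apply, weight_blockWeight]
  exact Finset.single_le_sum (f := fun a ↦ d ⟨i, a⟩) (fun _ _ ↦ Nat.zero_le _) (Finset.mem_univ a)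

/-- The multidegree `(d, …, d)` with `d = e * ∑ i, k i` contains at least `(e + 1) ^ ∑ i, k i`
monomials: the exponents of the variables `⟨i, a⟩` with `a ≠ 0` may be chosen freely in `0, …, e`,
and that of `⟨i, 0⟩` is then determined. -/
theorem exists_linearIndependent_weightedHomogeneous (k : ι → ℕ) (e : ℕ) :
    ∃ v : (∀ i, Fin (k i) → Fin (e + 1)) → MvPolynomial (Σ i, Fin (k i + 1)) ℂ,
      LinearIndependent ℂ v ∧ ∀ α, IsWeightedHomogeneous (blockWeight k) (v α)
        fun _ ↦ e * ∑ i, k i := by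
  let E (α : ∀ i, Fin (k i) → Fin (e + 1)) : (Σ i, Fin (k i + 1)) →₀ ℕ :=
    equivFunOnFinite.symm fun s ↦ Fin.cons (α := fun _ ↦ ℕ) (e * ∑ i, k i - ∑ a, (α s.1 a : ℕ))
      (fun a ↦ (α s.1 a : ℕ)) s.2
  have hE : Function.Injective E := by
    intro α β h
    funext i a
    have := DFunLike.congr_fun h ⟨i, a.succ⟩
    simpa [E, Fin.ext_iff] using this
  refine ⟨fun α ↦ monomial (E α) 1, ?_, fun α ↦ isWeightedHomogeneous_monomial _ _ _ ?_⟩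
  · have := (basisMonomials (Σ i, Fin (k i + 1)) ℂ).linearIndependent.comp E hE
    simpa [Function.comp_def] using this
  · funext i
    rw [weight_blockWeight, Fin.sum_univ_succ]
    simp only [E, equivFunOnFinite_symm_apply_apply, Fin.cons_zero, Fin.cons_succ]
    refine Nat.sub_add_cancel ?_
    calc ∑ a, (α i a : ℕ) ≤ ∑ _a : Fin (k i), e := Finset.sum_le_sum fun a _ ↦ (α i a).is_le
      _ = e * k i := by simp [mul_comm]
      _ ≤ _ := Nat.mul_le_mul_left e
        (Finset.single_le_sum (fun _ _ ↦ Nat.zero_le _) (Finset.mem_univ i))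

/-- There are always common zeros of `∑ i, k i` multilinear forms on the product of the projective
spaces of dimensions `k i`. Otherwise the dimension of the multidegree `(d, …, d)` part of the
polynomial ring, which grows at least like `d ^ N` with `N = ∑ i, k i`, would be bounded by a
multiple of the number of monomials of degree `d` in `N` variables, which grows like
`d ^ (N - 1)`. -/
theorem exists_form_eq_zero {J : Type*} [Fintype J] (hJ : Fintype.card J = ∑ i, k i)
    (F : J → MultiMatrix k) :
    ∃ x : ∀ i, Fin (k i + 1) → ℂ, (∀ i, x i ≠ 0) ∧ ∀ j, (F j).form x = 0 := by
  classical
  by_contra! hF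
  -- The exponent `N - 1` of the upper bound requires `N > 0`; for `N = 0` there are no equations.
  obtain hN | hN := (Fintype.card J).eq_zero_or_pos
  · obtain ⟨j, -⟩ := hF (fun _ _ ↦ 1) fun i h ↦ one_ne_zero (congrFun h 0)
    exact (Fintype.card_eq_zero_iff.1 hN).elim j
  obtain ⟨D, hD⟩ := exists_monomial_mem_span_toPoly hF
  let S (n : ℕ) : Submodule ℂ (MvPolynomial (Σ i, Fin (k i + 1)) ℂ) :=
    weightedHomogeneousSubmodule ℂ (blockWeight k) fun _ ↦ n
  have hS (n : ℕ) (hn : D ≤ n) :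
      S (n + 1) ≤ ⨆ j, (S n).map (LinearMap.mulLeft ℂ (F j).toPoly) :=
    weightedHomogeneousSubmodule_succ_le_iSup fun d hd ↦ hD d fun i ↦ by
      rw [hd]; exact Nat.le_succ_of_le hn
  let T : Set ((Σ i, Fin (k i + 1)) →₀ ℕ) := {d | weight (blockWeight k) d = fun _ ↦ D}
  let _ : Fintype T := (finite_setOf_weight_blockWeight_eq _).fintype
  have hb : S D ≤ Submodule.span ℂ (Set.range fun d : T ↦ monomial d.1 (1 : ℂ)) := by
    intro p hp
    rw [p.as_sum]
    refine sum_mem fun d hd ↦ ?_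
    rw [← mul_one (coeff d p), ← smul_eq_mul, ← smul_monomial]
    exact Submodule.smul_mem _ _
      (Submodule.subset_span ⟨⟨d, hp (MvPolynomial.mem_support_iff.1 hd)⟩, rfl⟩)
  set N := Fintype.card J
  set c := Fintype.card T
  -- Both dimension bounds are used in degree `e * N = D + n`. They give
  -- `(e + 1) ^ N ≤ c * (N * (e + 1)) ^ (N - 1)`, that is, `e + 1 ≤ c * N ^ (N - 1)`.
  let e := D + c * N ^ (N - 1)
  obtain ⟨n, hn⟩ : ∃ n, e * N = D + n :=
    Nat.exists_eq_add_of_le ((Nat.le_add_right D _).trans (Nat.le_mul_of_pos_right e hN))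
  obtain ⟨v, hv, hvS⟩ := exists_linearIndependent_weightedHomogeneous k e
  rw [← hJ, hn] at hvS
  have hspan : Set.range v ⊆ Submodule.span ℂ (Set.range fun s : Sym J n × T ↦
      (s.1.1.map fun j ↦ (F j).toPoly).prod * monomial s.2.1 (1 : ℂ)) := by
    rintro _ ⟨α, rfl⟩
    exact Submodule.le_span_sym_map_prod_mul _ S D hS _ hb n (hvS α)
  have hcard := linearIndependent_le_span' v hv _ hspan
  have h1 : (e + 1) ^ N ≤ Fintype.card (Sym J n × T) := by
    rw [Cardinal.mk_fintype, Nat.cast_le] at hcard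
    refine (Eq.le ?_).trans (hcard.trans (Fintype.card_range_le _))
    simp [Fintype.card_pi, Finset.prod_pow_eq_pow_sum, N, hJ]
  have h2 : Fintype.card (Sym J n × T) ≤ (N * (e + 1)) ^ (N - 1) * c := by
    rw [Fintype.card_prod, Sym.card_sym_eq_choose]
    refine Nat.mul_le_mul_right c ?_
    rw [Nat.choose_symm_of_eq_add (show N + n - 1 = n + (N - 1) by omega)]
    refine (Nat.choose_le_pow _ _).trans (Nat.pow_le_pow_left ?_ _)
    rw [mul_add, mul_comm N e]
    omega
  have h3 : (e + 1) ^ (N - 1) * (e + 1) ≤ (e + 1) ^ (N - 1) * (c * N ^ (N - 1)) := by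
    rw [← pow_succ, Nat.sub_add_cancel hN]
    refine (h1.trans h2).trans_eq ?_
    rw [mul_pow]; ring
  have h4 := Nat.le_of_mul_le_mul_left h3 (by positivity)
  omega

end MultiMatrix

/-! ### Forms, contractions and degeneracy -/

namespace MultiMatrix

variable {ι κ : Type*} [DecidableEq ι] [DecidableEq κ] {k : ι → ℕ} {l : κ → ℕ}

theorem glue_self (o : ι) (h : Fin (k o + 1)) (m : ∀ i : {i // i ≠ o}, Fin (k i + 1)) :
    glue o h m o = h := by
  simp [glue, Equiv.piSplitAt]

theorem glue_of_ne (o : ι) (h : Fin (k o + 1)) (m : ∀ i : {i // i ≠ o}, Fin (k i + 1))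
    (i : {i // i ≠ o}) : glue o h m i = m i := by
  simp [glue, Equiv.piSplitAt, i.2]

variable [Fintype ι] [Fintype κ]

theorem form_eq_sum_mul_apply (A : MultiMatrix k) (o : ι) (x : ∀ i, Fin (k i + 1) → ℂ) :
    A.form x = ∑ h, x o h * A.apply o (fun i ↦ x i) h := by
  rw [form, ← (Equiv.piSplitAt o fun i ↦ Fin (k i + 1)).symm.sum_comp, Fintype.sum_prod_type]
  refine Finset.sum_congr rfl fun h _ ↦ ?_
  rw [apply, Finset.mul_sum]
  refine Finset.sum_congr rfl fun m _ ↦ ?_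
  change A (glue o h m) * ∏ i, x i (glue o h m i) = _
  rw [Fintype.prod_eq_mul_prod_subtype_ne _ o, glue_self]
  simp only [glue_of_ne]
  ring

/-- The analogue, for the single index `o`, of the condition in `IsTangentDegenerate`; the vector
`x o` plays no role. -/
theorem apply_eq_zero_iff (A : MultiMatrix k) (o : ι) (x : ∀ i, Fin (k i + 1) → ℂ) :
    A.apply o (fun i ↦ x i) = 0 ↔ ∀ y, A.form (Function.update x o y) = 0 := by
  have h (y) : A.form (Function.update x o y) = ∑ h, y h * A.apply o (fun i ↦ x i) h := by
    rw [form_eq_sum_mul_apply A o, Function.update_self]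
    simp only [fun i : {i // i ≠ o} ↦ Function.update_of_ne i.2 y x]
  refine ⟨fun h0 y ↦ by simp [h, h0], fun h0 ↦ funext fun i ↦ ?_⟩
  have := h (Pi.single i 1)
  rw [h0] at this
  simpa [Pi.single_apply] using this.symm

theorem isDegenerate_iff (A : MultiMatrix k) (o : ι) :
    A.IsDegenerate o ↔ ∃ x : ∀ i, Fin (k i + 1) → ℂ, (∀ i, x i ≠ 0) ∧
      ∀ y, A.form (Function.update x o y) = 0 := by
  constructor
  · rintro ⟨v, hv, h⟩
    let x : ∀ i, Fin (k i + 1) → ℂ := fun i ↦ if hi : i = o then 1 else v ⟨i, hi⟩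
    have hx (i : {i // i ≠ o}) : x i = v i := dif_neg i.2
    refine ⟨x, fun i ↦ ?_, (apply_eq_zero_iff A o x).1 (by simpa only [hx] using h)⟩
    by_cases hi : i = o
    · simp [x, hi]
    · simpa [x, hi] using hv ⟨i, hi⟩
  · rintro ⟨x, hx, h⟩
    exact ⟨fun i ↦ x i, fun i ↦ hx i, (apply_eq_zero_iff A o x).2 h⟩

theorem conv_form (A : MultiMatrix k) (B : MultiMatrix l) (r : ι) (s : κ) (hrs : k r = l s)
    (x : ∀ i, Fin (convFormat k l r s i + 1) → ℂ) :
    (A.conv B r s hrs).form x =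
      ∑ h, A.apply r (fun i ↦ x (Sum.inl i)) h *
        B.apply s (fun j ↦ x (Sum.inr j)) (Fin.cast (congrArg (· + 1) hrs) h) := by
  rw [form, ← (Equiv.sumPiEquivProdPi fun i ↦ Fin (convFormat k l r s i + 1)).symm.sum_comp,
    Fintype.sum_prod_type]
  simp only [apply, Finset.sum_mul_sum]
  symm
  rw [Finset.sum_comm]
  refine Finset.sum_congr rfl fun m _ ↦ ?_
  rw [Finset.sum_comm]
  refine Finset.sum_congr rfl fun n _ ↦ ?_
  rw [Fintype.prod_sum_type, conv, Finset.sum_mul]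
  refine Finset.sum_congr rfl fun h _ ↦ ?_
  exact mul_mul_mul_comm _ _ _ _

/-- Contraction is composition: the form of `A ∗_{r,s} B` is that of `B` with the value of `A`
substituted for the argument of index `s`. -/
theorem conv_form_eq_form (A : MultiMatrix k) (B : MultiMatrix l) (r : ι) (s : κ) (hrs : k r = l s)
    (z : ∀ i, Fin (convFormat k l r s i + 1) → ℂ) (x : ∀ j, Fin (l j + 1) → ℂ)
    (hs : x s = A.apply r (fun i ↦ z (Sum.inl i)) ∘ Fin.cast (congrArg (· + 1) hrs.symm))
    (hx : ∀ j : {j // j ≠ s}, x j = z (Sum.inr j)) :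
    (A.conv B r s hrs).form z = B.form x := by
  rw [conv_form, form_eq_sum_mul_apply B s, hs,
    ← (finCongr (congrArg (· + 1) hrs)).sum_comp]
  simp only [hx]
  rfl

/-- If `A` kills `⊗ v` and `B` kills `⊗ w`, then in every partial derivative of the form of the
convolution at `(v, w)` one of the two factors of each summand is untouched and vanishes. -/
theorem isTangentDegenerate_conv {A : MultiMatrix k} {B : MultiMatrix l} {r : ι} {s : κ}
    (hrs : k r = l s) (hA : A.IsDegenerate r) (hB : B.IsDegenerate s) :
    (A.conv B r s hrs).IsTangentDegenerate := by
  obtain ⟨v, hv, hAv⟩ := hA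
  obtain ⟨w, hw, hBw⟩ := hB
  refine ⟨Sum.rec v w, by rintro (i | j); exacts [hv i, hw j], ?_⟩
  rintro (i | j) y
  · rw [conv_form]
    refine Finset.sum_eq_zero fun h _ ↦ mul_eq_zero_of_right _ ?_
    simp only [ne_eq, reduceCtorEq, not_false_eq_true, Function.update_of_ne]
    exact congrFun hBw _
  · rw [conv_form]
    refine Finset.sum_eq_zero fun h _ ↦ mul_eq_zero_of_left ?_ _
    simp only [ne_eq, reduceCtorEq, not_false_eq_true, Function.update_of_ne]
    exact congrFun hAv _

theorem conv_isDegenerate_iff (A : MultiMatrix k) (B : MultiMatrix l) (r : ι) {s t : κ}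
    (hst : s ≠ t) (hrs : k r = l s) :
    (A.conv B r s hrs).IsDegenerate (Sum.inr ⟨t, hst.symm⟩) ↔
      ∃ v : ∀ i : {i // i ≠ r}, Fin (k i + 1) → ℂ, (∀ i, v i ≠ 0) ∧
      ∃ x : ∀ j, Fin (l j + 1) → ℂ, (∀ j ≠ s, x j ≠ 0) ∧
        x s = A.apply r v ∘ Fin.cast (congrArg (· + 1) hrs.symm) ∧
        ∀ y, B.form (Function.update x t y) = 0 := by
  rw [isDegenerate_iff]
  have key (z : ∀ i, Fin (convFormat k l r s i + 1) → ℂ) (x : ∀ j, Fin (l j + 1) → ℂ)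
      (hs : x s = A.apply r (fun i ↦ z (Sum.inl i)) ∘ Fin.cast (congrArg (· + 1) hrs.symm))
      (hx : ∀ j : {j // j ≠ s}, x j = z (Sum.inr j))
      (y : Fin (convFormat k l r s (Sum.inr ⟨t, hst.symm⟩) + 1) → ℂ) :
      (A.conv B r s hrs).form (Function.update z (Sum.inr ⟨t, hst.symm⟩) y) =
        B.form (Function.update x t y) := by
    refine conv_form_eq_form A B r s hrs _ _ ?_ fun ⟨j, hj⟩ ↦ ?_
    · refine (Function.update_of_ne hst _ _).trans (hs.trans ?_)
      exact congrArg (fun v ↦ A.apply r v ∘ Fin.cast (congrArg (· + 1) hrs.symm)) <|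
        funext fun i ↦ (Function.update_of_ne Sum.inl_ne_inr _ _).symm
    · obtain rfl | hjt := eq_or_ne j t
      · exact (Function.update_self _ _ _).trans
          (Function.update_self (Sum.inr ⟨j, hj⟩ : {i // i ≠ r} ⊕ {j // j ≠ s}) y z).symm
      · refine (Function.update_of_ne hjt _ _).trans ((hx ⟨j, hj⟩).trans ?_)
        exact (Function.update_of_ne (by simpa using hjt) _ _).symm
  constructor
  · rintro ⟨z, hz, h⟩
    let x : ∀ j, Fin (l j + 1) → ℂ := (Equiv.piSplitAt s fun j ↦ Fin (l j + 1) → ℂ).symm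
      (A.apply r (fun i ↦ z (Sum.inl i)) ∘ Fin.cast (congrArg (· + 1) hrs.symm),
        fun j ↦ z (Sum.inr j))
    have hs : x s = _ := congrArg Prod.fst ((Equiv.piSplitAt s _).apply_symm_apply _)
    have hx (j : {j // j ≠ s}) : x j = z (Sum.inr j) :=
      congrFun (congrArg Prod.snd ((Equiv.piSplitAt s _).apply_symm_apply _)) j
    refine ⟨fun i ↦ z (Sum.inl i), fun i ↦ hz _, x, fun j hj ↦ ?_, hs, fun y ↦ ?_⟩
    · rw [hx ⟨j, hj⟩]
      exact hz _
    · exact (key z x hs hx y).symm.trans (h y)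
  · rintro ⟨v, hv, x, hx, hs, h⟩
    let z : ∀ i, Fin (convFormat k l r s i + 1) → ℂ := Sum.rec v fun j ↦ x j
    refine ⟨z, ?_, fun y ↦ (key z x hs (fun _ ↦ rfl) y).trans (h y)⟩
    rintro (i | j)
    exacts [hv i, hx j j.2]

theorem form_update_smul (A : MultiMatrix k) (o : ι) (c : ℂ) (x : ∀ i, Fin (k i + 1) → ℂ) :
    A.form (Function.update x o (c • x o)) = c * A.form x := by
  rw [form_eq_sum_mul_apply A o, form_eq_sum_mul_apply A o, Function.update_self, Finset.mul_sum]
  simp only [fun i : {i // i ≠ o} ↦ Function.update_of_ne i.2 (c • x o) x, Pi.smul_apply,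
    smul_eq_mul, mul_assoc]

theorem IsNondegenerate.conv {A : MultiMatrix k} {B : MultiMatrix l} {r : ι} {s t : κ}
    (hst : s ≠ t) (hrs : k r = l s) (hA : A.IsNondegenerate r) (hB : B.IsNondegenerate t) :
    (A.conv B r s hrs).IsNondegenerate (Sum.inr ⟨t, hst.symm⟩) := by
  intro h
  obtain ⟨v, hv, x, hx, hs, h⟩ := (conv_isDegenerate_iff A B r hst hrs).1 h
  refine hB ((isDegenerate_iff B t).2 ⟨x, fun j ↦ ?_, h⟩)
  obtain rfl | hj := eq_or_ne j s
  · refine fun h0 ↦ hA ⟨v, hv, funext fun a ↦ ?_⟩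
    simpa [h0] using (congrFun hs (Fin.cast (congrArg (· + 1) hrs) a)).symm
  · exact hx j hj

/-- If the value of `A` at `v` is a multiple `c • x s` and `B` is degenerate at `x`, then the
convolution is degenerate at `(v, x)`. If `c = 0`, no condition on `B` is needed. -/
theorem conv_isDegenerate_of_apply_eq_smul {A : MultiMatrix k} {B : MultiMatrix l} {r : ι}
    {s t : κ} (hst : s ≠ t) (hrs : k r = l s) {v : ∀ i : {i // i ≠ r}, Fin (k i + 1) → ℂ}
    (hv : ∀ i, v i ≠ 0) {x : ∀ j, Fin (l j + 1) → ℂ} (hx : ∀ j, x j ≠ 0) {c : ℂ}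
    (hc : A.apply r v = c • x s ∘ Fin.cast (congrArg (· + 1) hrs))
    (h : c = 0 ∨ ∀ y, B.form (Function.update x t y) = 0) :
    (A.conv B r s hrs).IsDegenerate (Sum.inr ⟨t, hst.symm⟩) := by
  refine (conv_isDegenerate_iff A B r hst hrs).2
    ⟨v, hv, Function.update x s (c • x s), fun j hj ↦ ?_, ?_, fun y ↦ ?_⟩
  · rw [Function.update_of_ne hj]
    exact hx j
  · rw [Function.update_self, hc]
    rfl
  · have := form_update_smul B s c (Function.update x t y)
    rw [Function.update_of_ne hst, Function.update_comm hst.symm] at this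
    rw [this]
    obtain rfl | h := h
    · exact zero_mul _
    · rw [h, mul_zero]

/-- In boundary format, every nonzero vector of `V o` is met up to a scalar by the values of `A` on
decomposable tensors with nonzero factors: these vectors are cut out by `k o = ∑ i ≠ o, k i`
multilinear equations. The scalar `c` may vanish, but only if `A` is degenerate. -/
theorem IsBoundaryFormat.exists_apply_eq_smul {o : ι} (hk : IsBoundaryFormat k o)
    (A : MultiMatrix k) {u : Fin (k o + 1) → ℂ} (hu : u ≠ 0) :
    ∃ v : ∀ i : {i // i ≠ o}, Fin (k i + 1) → ℂ, (∀ i, v i ≠ 0) ∧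
      ∃ c : ℂ, A.apply o v = c • u := by
  have hfin : Module.finrank ℂ ((Fin (k o + 1) → ℂ) ⧸ (ℂ ∙ u)) = k o := by
    have := Submodule.finrank_quotient_add_finrank (ℂ ∙ u)
    rw [finrank_span_singleton hu, Module.finrank_fin_fun] at this
    omega
  -- `L` is a linear map onto `ℂ ^ (k o)` with kernel spanned by `u`.
  let L := (LinearEquiv.ofFinrankEq ((Fin (k o + 1) → ℂ) ⧸ (ℂ ∙ u)) (Fin (k o) → ℂ)
    (by rw [hfin, Module.finrank_fin_fun])).toLinearMap ∘ₗ (ℂ ∙ u).mkQ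
  have hL (z) (hz : L z = 0) : ∃ c : ℂ, c • u = z := by
    rw [← Submodule.mem_span_singleton]
    simpa [L] using hz
  let F (j : Fin (k o)) : MultiMatrix fun i : {i // i ≠ o} ↦ k i :=
    fun m ↦ L (fun h ↦ A (glue o h m)) j
  have hF (j v) : (F j).form v = L (A.apply o v) j := by
    have : A.apply o v = ∑ m : ∀ i : {i // i ≠ o}, Fin (k i + 1),
        (∏ i, v i (m i)) • fun h ↦ A (glue o h m) := by
      ext h
      simp [apply, mul_comm]
    rw [this, map_sum, Finset.sum_apply]
    simp [form, F, mul_comm]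
  obtain ⟨v, hv, hv0⟩ := exists_form_eq_zero ((Fintype.card_fin _).trans hk) F
  obtain ⟨c, hc⟩ := hL (A.apply o v) (funext fun j ↦ (hF j v).symm.trans (hv0 j))
  exact ⟨v, hv, c, hc.symm⟩

/-! ### Matrices supported at two opposite multi-indices -/

theorem form_eq_of_support_pair {A : MultiMatrix k} {a b : ∀ i, Fin (k i + 1)} (hab : a ≠ b)
    (hA : ∀ m, A m ≠ 0 → m = a ∨ m = b) (x : ∀ i, Fin (k i + 1) → ℂ) :
    A.form x = A a * ∏ i, x i (a i) + A b * ∏ i, x i (b i) := by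
  refine Finset.sum_eq_add a b hab (fun m _ hm ↦ ?_) (by simp) (by simp)
  rw [not_imp_comm.1 (hA m) (by tauto), zero_mul]

/-- Both monomials of the form vanish at `x`, whatever `x r` is, if `x s` is the basis vector of
`a` and `x t` that of `b`. -/
theorem isDegenerate_of_support_pair {A : MultiMatrix k} {a b : ∀ i, Fin (k i + 1)}
    (hab : ∀ i, a i ≠ b i) (hA : ∀ m, A m ≠ 0 → m = a ∨ m = b) {r s t : ι}
    (hsr : s ≠ r) (htr : t ≠ r) (hst : s ≠ t) : A.IsDegenerate r := by
  rw [isDegenerate_iff]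
  let x : ∀ i, Fin (k i + 1) → ℂ := fun i ↦ Pi.single (if i = s then a i else b i) 1
  refine ⟨x, fun i ↦ by simp [x], fun y ↦ ?_⟩
  rw [form_eq_of_support_pair (fun h ↦ hab r (congrFun h r)) hA,
    Finset.prod_eq_zero (Finset.mem_univ t), Finset.prod_eq_zero (Finset.mem_univ s)]
  · simp
  · simp [x, Function.update_of_ne hsr, (hab s).symm]
  · simp [x, Function.update_of_ne htr, hst.symm, hab t]

/-- The vanishing of the partial derivative along the basis vector `a i` in the argument of
index `i` says that the monomial of `a`, without its factor of index `i`, vanishes at `x`. -/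
theorem exists_ne_apply_eq_zero {A : MultiMatrix k} {a b : ∀ i, Fin (k i + 1)}
    (hab : ∀ i, a i ≠ b i) (hA : ∀ m, A m ≠ 0 → m = a ∨ m = b) (ha : A a ≠ 0)
    {x : ∀ i, Fin (k i + 1) → ℂ} (i : ι) (h : ∀ y, A.form (Function.update x i y) = 0) :
    ∃ j ≠ i, x j (a j) = 0 := by
  have h0 := h (Pi.single (a i) 1)
  have hb : ∏ j, Function.update x i (Pi.single (a i) 1) j (b j) = 0 :=
    Finset.prod_eq_zero (Finset.mem_univ i) (by simp [(hab i).symm])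
  rw [form_eq_of_support_pair (fun h ↦ hab i (congrFun h i)) hA, hb, mul_zero, add_zero,
    mul_eq_zero_iff_left ha, Finset.prod_eq_zero_iff] at h0
  obtain ⟨j, -, hj⟩ := h0
  obtain rfl | hji := eq_or_ne j i
  · simp at hj
  · exact ⟨j, hji, by rwa [Function.update_of_ne hji] at hj⟩

/-- At a tangent zero `x`, each of the coordinates `x j (a j)` and `x j (b j)` would vanish for at
least two of the three indices `j`, hence both for a common `j`, and `x j` would be zero. -/
theorem not_isTangentDegenerate_of_support_pair {A : MultiMatrix fun _ : Fin 3 ↦ 1}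
    {a b : Fin 3 → Fin 2} (hab : ∀ i, a i ≠ b i) (hA : ∀ m, A m ≠ 0 ↔ m = a ∨ m = b) :
    ¬ A.IsTangentDegenerate := by
  rintro ⟨x, hx, h⟩
  have h0 (i : Fin 3) : ∃ j ≠ i, x j (a j) = 0 :=
    exists_ne_apply_eq_zero hab (fun m ↦ (hA m).1) ((hA a).2 (Or.inl rfl)) i (h i)
  have h1 (i : Fin 3) : ∃ j ≠ i, x j (b j) = 0 :=
    exists_ne_apply_eq_zero (fun i ↦ (hab i).symm) (fun m hm ↦ ((hA m).1 hm).symm)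
      ((hA b).2 (Or.inr rfl)) i (h i)
  have hx' (i : Fin 3) (hai : x i (a i) = 0) : x i (b i) ≠ 0 := fun hbi ↦ hx i <| by
    funext c
    have two : ∀ a b c : Fin 2, a ≠ b → c = a ∨ c = b := by decide
    obtain rfl | rfl := two _ _ c (hab i)
    exacts [hai, hbi]
  obtain ⟨j, -, hj⟩ := h0 0
  obtain ⟨j', hjj, hj'⟩ := h0 j
  obtain ⟨i, hij, hi⟩ := h1 j
  obtain ⟨i', hii, hi'⟩ := h1 i
  have hij' : i ≠ j' := fun e ↦ hx' j' hj' (e ▸ hi)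
  have hij1 : i' ≠ j := fun e ↦ hx' j hj (e ▸ hi')
  have hij2 : i' ≠ j' := fun e ↦ hx' j' hj' (e ▸ hi')
  omega

end MultiMatrix

theorem corollary4p5 :
    (∀ (p q : ℕ) (k : Fin (p + 1) → ℕ) (l : Fin (q + 1) → ℕ)
      (_ : MultiMatrix.IsBoundaryFormat k 0) (_ : MultiMatrix.IsBoundaryFormat l 0)
      (j : Fin (q + 1)) (hj : j ≠ 0) (hkl : k 0 = l j)
      (A : MultiMatrix k) (B : MultiMatrix l),
      (A.conv B 0 j hkl).IsNondegenerate (Sum.inr ⟨0, hj.symm⟩) ↔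
        A.IsNondegenerate 0 ∧ B.IsNondegenerate 0) ∧
    (∀ A B : MultiMatrix (fun _ : Fin 3 => 1),
      (∀ m, A m ≠ 0 ↔ m = ![0, 0, 0] ∨ m = ![1, 1, 1]) →
      (∀ m, B m ≠ 0 ↔ m = ![0, 0, 1] ∨ m = ![1, 1, 0]) →
      ¬ A.IsTangentDegenerate ∧ ¬ B.IsTangentDegenerate ∧
        ∀ r s : Fin 3, (A.conv B r s rfl).IsTangentDegenerate) := by
  refine ⟨fun p q k l hk _ j hj hkl A B ↦ ⟨fun h ↦ ?_, fun h ↦ h.1.conv hj hkl h.2⟩, ?_⟩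
  · refine ⟨?_, fun hB ↦ ?_⟩
    · rintro ⟨v, hv, hAv⟩
      exact h (MultiMatrix.conv_isDegenerate_of_apply_eq_smul hj hkl hv (x := 1)
        (fun _ ↦ one_ne_zero) (c := 0) (by rw [hAv, zero_smul]) (Or.inl rfl))
    · obtain ⟨x, hx, hBx⟩ := (MultiMatrix.isDegenerate_iff B 0).1 hB
      have hu : x j ∘ Fin.cast (congrArg (· + 1) hkl) ≠ 0 := fun h0 ↦ hx j <| funext fun a ↦
        congrFun h0 (Fin.cast (congrArg (· + 1) hkl.symm) a)
      obtain ⟨v, hv, c, hc⟩ := hk.exists_apply_eq_smul A hu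
      exact h (MultiMatrix.conv_isDegenerate_of_apply_eq_smul hj hkl hv hx hc (Or.inr hBx))
  · intro A B hA hB
    have ha : ∀ i : Fin 3, (![0, 0, 0] : Fin 3 → Fin 2) i ≠ ![1, 1, 1] i := by decide
    have hb : ∀ i : Fin 3, (![0, 0, 1] : Fin 3 → Fin 2) i ≠ ![1, 1, 0] i := by decide
    have h3 : ∀ r : Fin 3, r + 1 ≠ r ∧ r + 2 ≠ r ∧ r + 1 ≠ r + 2 := by decide
    refine ⟨MultiMatrix.not_isTangentDegenerate_of_support_pair ha hA,
      MultiMatrix.not_isTangentDegenerate_of_support_pair hb hB, fun r s ↦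
        MultiMatrix.isTangentDegenerate_conv (k := fun _ ↦ 1) (l := fun _ ↦ 1) (r := r) (s := s)
          rfl ?_ ?_⟩
    · exact MultiMatrix.isDegenerate_of_support_pair ha (fun m ↦ (hA m).1)
        (h3 r).1 (h3 r).2.1 (h3 r).2.2
    · exact MultiMatrix.isDegenerate_of_support_pair hb (fun m ↦ (hB m).1)
        (h3 s).1 (h3 s).2.1 (h3 s).2.2
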